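/- Let $(R,\mathfrak m)$ be a complete Noetherian local ring with $\dim R=2$ which is seminormal (whenever $b,c\in R$ satisfy $b^3=c^2$ there is $a\in R$ with $a^2=b$, $a^3=c$; in particular $R$ is reduced), satisfies Serre's condition $(R_1)$ ($R_{\mathfrak p}$ is regular for every prime $\mathfrak p$ of height at most $1$), and is equidimensional ($\dim R/\mathfrak p=2$ for every minimal prime $\mathfrak p$). Then $R$ is Buchsbaum, i.e. every system of parameters $x_1,x_2$ of $R$ satisfies $\mathfrak m\,\big((x_1,\dots,x_{i-1}):x_i\big)\subseteq(x_1,\dots,x_{i-1})$ for $i=1,2$. Moreover, let $\overline R$ be the integral closure of $R$ in its total ring of fractions and $\mathfrak C=\operatorname{Ann}_R(\overline R/R)$ the conductor. Then $\mathfrak C=\operatorname{Ann}_R H^1_{\mathfrak m}(R)$, and if $R$ is not normal (i.e. $R\neq\overline R$), then $\mathfrak C=\mathfrak m=\operatorname{Ann}_R H^1_{\mathfrak m}(R)$. -/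

import Mathlib

/-- Seminormality in the sense of Swan: whenever `b ^ 3 = c ^ 2`, there is an element `a` with
`a ^ 2 = b` and `a ^ 3 = c`. Such a ring is automatically reduced, see
`IsSeminormalRing.isReduced`. -/
def IsSeminormalRing (R : Type*) [CommRing R] : Prop :=
  ∀ b c : R, b ^ 3 = c ^ 2 → ∃ a : R, a ^ 2 = b ∧ a ^ 3 = c

theorem IsSeminormalRing.isReduced {R : Type*} [CommRing R] (h : IsSeminormalRing R) :
    IsReduced R := by
  refine isReduced_iff_pow_one_lt 2 one_lt_two |>.2 fun x hx => ?_
  obtain ⟨a, ha, ha'⟩ := h 0 x (by simp [hx])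
  rw [← ha', pow_succ, ha, zero_mul]

/-- Serre's condition `(R_n)`: the localization at every prime of height at most `n` is regular. -/
def SatisfiesSerreR (R : Type*) [CommRing R] (n : ℕ) : Prop :=
  ∀ (p : Ideal R) [p.IsPrime], p.height ≤ n → IsRegularLocalRing (Localization.AtPrime p)

/-- `R` is equidimensional: `dim R/p = dim R` for every minimal prime `p`. -/
def IsEquidimensionalRing (R : Type*) [CommRing R] : Prop :=
  ∀ p ∈ minimalPrimes R, ringKrullDim (R ⧸ p) = ringKrullDim R

/-- `x_1, …, x_d` is a system of parameters of the local ring `R`: `d = dim R` and the ideal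
generated by the `x_i` is primary to the maximal ideal. -/
def IsSystemOfParameters (R : Type*) [CommRing R] [IsLocalRing R] {d : ℕ} (x : Fin d → R) : Prop :=
  ringKrullDim R = d ∧ (Ideal.span (Set.range x)).radical = IsLocalRing.maximalIdeal R

/-- A (Noetherian) local ring `(R, 𝔪)` is Buchsbaum if every system of parameters `x_1, …, x_d`
is a weak sequence: `𝔪 ((x_1, …, x_{i-1}) : x_i) ⊆ (x_1, …, x_{i-1})` for all `i`. -/
def IsBuchsbaumRing (R : Type*) [CommRing R] [IsLocalRing R] : Prop :=
  ∀ (d : ℕ) (x : Fin d → R), IsSystemOfParameters R x →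
    ∀ (i : Fin d) (a : R), a * x i ∈ Ideal.span (x '' Set.Iio i) →
      ∀ r ∈ IsLocalRing.maximalIdeal R, r * a ∈ Ideal.span (x '' Set.Iio i)

/-- The normalization `R̄`: the integral closure of `R` in its total ring of fractions. -/
abbrev Normalization (R : Type*) [CommRing R] : Subalgebra R (FractionRing R) :=
  integralClosure R (FractionRing R)

/-- The conductor ideal `Ann_R (R̄ / R)`. -/
noncomputable def conductorIdeal (R : Type*) [CommRing R] : Ideal R :=
  Module.annihilator R (Normalization R ⧸ LinearMap.range (Algebra.linearMap R (Normalization R)))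

/-!
For `x` in the total ring of fractions `K` of `R`, let `(R : x)` be its denominator ideal. By
`(R₁)`, the ring `R` is normal at every prime other than `𝔪`, so if `x` is integral over `R` then
`(R : x)` is `R` or `𝔪`-primary.

Conversely `x` is integral as soon as `𝔪 ≤ √(R : x)`. It suffices to check this modulo each minimal
prime, that is, over a complete local domain `D` of dimension at least two. There `𝔪_D` extends into
the radical of `(x⁻¹)` in `D[x⁻¹]`. If `x⁻¹` were not a unit of `D[x⁻¹]`, then either `𝔪_D` extends
to a prime of `D[x⁻¹]` not containing `x⁻¹`, or, by Weierstrass preparation, `D[x⁻¹]` is integral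
over `D`; both contradict Krull's principal ideal theorem. So `x⁻¹` is a unit of `D[x⁻¹]`, which
says that `x` is integral over `D`.

If `x` is integral and `r ∈ 𝔪`, then `(r x) ^ n ∈ R` for all large `n`. Seminormality brings the
threshold down by one step at a time, from `2n` and `3n` to `n`, until `r x ∈ R`. Hence `𝔪`
multiplies every integral `x` into `R`, so the conductor contains `𝔪`. Moreover, if
`a x₂ = c x₁`, then the fraction `a / x₁ = c / x₂` is multiplied into `R` by `x₁` and `x₂`, hence is
integral, so `𝔪 a ⊆ (x₁)`: this is the Buchsbaum property.

Finally `H¹_𝔪(R)` is the colimit of the `Ext¹(R / 𝔪ⁿ, R) ≅ Hom(R / 𝔪ⁿ, K / R)`, that is, the module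
of all `x ∈ K` with `𝔪 ≤ √(R : x)`, taken modulo `R`. These are the integral elements, so its
annihilator is the conductor.
-/
open IsLocalRing nonZeroDivisors

section Denominators

/-- The denominator ideal `{r | r x ∈ R}` of an element `x` of an `R`-algebra `K`, which in the
application is the total ring of fractions of `R`. -/
def denominatorIdeal (R : Type*) [CommRing R] {K : Type*} [CommRing K] [Algebra R K] (x : K) :
    Ideal R :=
  (1 : Submodule R K).colon {x}

theorem mem_denominatorIdeal {R K : Type*} [CommRing R] [CommRing K] [Algebra R K] {x : K} {r : R} :
    r ∈ denominatorIdeal R x ↔ ∃ a, algebraMap R K a = r • x :=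
  Submodule.mem_colon_singleton.trans Submodule.mem_one

end Denominators

section Weierstrass

open Polynomial

theorem exists_isDistinguishedAt_mul_of_map_residue_ne_zero {D : Type*} [CommRing D] [IsLocalRing D]
    [IsAdicComplete (maximalIdeal D) D] (g : D[X]) (hg : g.map (residue D) ≠ 0) :
    ∃ G H : D[X], G.IsDistinguishedAt (maximalIdeal D) ∧ IsUnit (H.coeff 0) ∧ g = G * H := by
  obtain ⟨G, H, hGH⟩ := PowerSeries.exists_isWeierstrassFactorization (g := (g : PowerSeries D))
    (by rwa [← Polynomial.polynomial_map_coe, Ne, Polynomial.coe_eq_zero_iff])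
  have hG := hGH.isDistinguishedAt
  have hdeg : (g %ₘ G).degree <
      ((G : PowerSeries D).map (Ideal.Quotient.mk (maximalIdeal D))).order.toNat := by
    rw [← hG.coe_natDegree_eq_order_map (G : PowerSeries D) 1 (by simp) (by simp)]
    exact (degree_modByMonic_lt g hG.monic).trans_eq (degree_eq_natDegree hG.monic.ne_zero)
  -- Weierstrass division by `G` is unique, so the power series `H` is the polynomial `g /ₘ G`.
  obtain ⟨hquot, hrem⟩ := hG.isWeierstrassDivisorAt'.eq_of_mul_add_eq_mul_add (q := H) (r := 0)
    (q' := (g /ₘ G : D[X])) (r' := g %ₘ G) (by simp) hdeg (by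
      rw [coe_zero, add_zero, ← hGH.eq_mul, ← coe_mul, ← coe_add, add_comm,
        modByMonic_add_div])
  refine ⟨G, g /ₘ G, hG, ?_, ?_⟩
  · have := hGH.isUnit.map (PowerSeries.constantCoeff (R := D))
    rwa [hquot, constantCoeff_coe] at this
  · conv_lhs => rw [← modByMonic_add_div g G, ← hrem, zero_add]

theorem isUnit_of_aeval_eq_zero_of_isUnit_coeff_zero {D S : Type*} [CommRing D] [CommRing S]
    [Algebra D S] {t : S} {H : D[X]} (hH : IsUnit (H.coeff 0)) (ht : aeval t H = 0) :
    IsUnit t := by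
  rw [← divX_mul_X_add H, map_add, map_mul, aeval_X, aeval_C, ← eq_neg_iff_add_eq_zero] at ht
  exact isUnit_of_mul_isUnit_right (ht ▸ (hH.map (algebraMap D S)).neg)

theorem isUnit_or_exists_isDistinguishedAt_of_aeval_eq_zero {D S : Type*} [CommRing D]
    [IsLocalRing D] [IsAdicComplete (maximalIdeal D) D] [CommRing S] [NoZeroDivisors S]
    [Algebra D S] {t : S} {g : D[X]} (hg : g.map (residue D) ≠ 0) (ht : aeval t g = 0) :
    IsUnit t ∨ ∃ G : D[X], G.IsDistinguishedAt (maximalIdeal D) ∧ aeval t G = 0 := by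
  obtain ⟨G, H, hG, hH, rfl⟩ := exists_isDistinguishedAt_mul_of_map_residue_ne_zero g hg
  rw [map_mul, mul_eq_zero] at ht
  exact ht.symm.imp (isUnit_of_aeval_eq_zero_of_isUnit_coeff_zero hH) (⟨G, hG, ·⟩)

end Weierstrass

section Krull

theorem mem_minimalPrimes_of_lt_of_mem_minimalPrimes_span_singleton {S : Type*} [CommRing S]
    [IsNoetherianRing S] {P Q : Ideal S} [P.IsPrime] {t : S}
    (hQ : Q ∈ (Ideal.span {t}).minimalPrimes) (h : P < Q) : P ∈ minimalPrimes S := by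
  have := hQ.isPrime
  have hle : P.height + 1 ≤ 0 + 1 :=
    (Ideal.height_add_one_le_of_lt_of_isPrime h).trans
      (Ideal.height_le_one_of_isPrincipal_of_mem_minimalPrimes _ Q hQ)
  exact Ideal.height_eq_zero_iff.1
    (nonpos_iff_eq_zero.1 ((WithTop.add_le_add_iff_right ENat.one_ne_top).1 hle))

theorem eq_bot_of_lt_of_mem_minimalPrimes_span_singleton {S : Type*} [CommRing S] [IsDomain S]
    [IsNoetherianRing S] {P Q : Ideal S} [P.IsPrime] {t : S}
    (hQ : Q ∈ (Ideal.span {t}).minimalPrimes) (h : P < Q) : P = ⊥ := by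
  simpa [IsDomain.minimalPrimes_eq_singleton_bot] using
    mem_minimalPrimes_of_lt_of_mem_minimalPrimes_span_singleton hQ h

theorem mem_of_le_radical_span_singleton {S : Type*} [CommRing S] [IsDomain S]
    [IsNoetherianRing S] {P : Ideal S} [P.IsPrime] (hP : P ≠ ⊥) {t : S} (ht : ¬ IsUnit t)
    (h : P ≤ (Ideal.span {t}).radical) : t ∈ P := by
  obtain ⟨Q, hQ⟩ : (Ideal.span {t}).minimalPrimes.Nonempty :=
    Set.nonempty_coe_sort.1 <|
      Ideal.nonempty_minimalPrimes (by rwa [Ne, Ideal.span_singleton_eq_top])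
  have hPQ : P ≤ Q := h.trans (hQ.isPrime.radical_le_iff.2 hQ.1.2)
  have : P = Q := eq_of_le_of_not_lt hPQ fun hlt =>
    hP (eq_bot_of_lt_of_mem_minimalPrimes_span_singleton hQ hlt)
  exact this ▸ hQ.1.2 (Ideal.mem_span_singleton_self t)

theorem exists_bot_lt_lt_of_one_lt_height {D : Type*} [CommRing D] [IsDomain D]
    {p : Ideal D} [p.IsPrime] (h : 1 < p.height) : ∃ q : Ideal D, q.IsPrime ∧ ⊥ < q ∧ q < p := by
  by_contra! hq
  refine h.not_ge ((Ideal.height_le_iff (n := 1)).2 fun q hqp hlt => ?_)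
  have : q = ⊥ := not_bot_lt_iff.1 fun hbot => hq q hqp hbot hlt
  simp [this]

theorem height_le_one_of_radical_map_eq_radical_span_singleton {D S : Type*} [CommRing D]
    [IsDomain D] [CommRing S] [IsDomain S] [IsNoetherianRing S] [Algebra D S] [FaithfulSMul D S]
    [Algebra.IsIntegral D S] {p : Ideal D} [p.IsPrime] {t : S}
    (h : (p.map (algebraMap D S)).radical = (Ideal.span {t}).radical) : p.height ≤ 1 := by
  by_contra! hp
  obtain ⟨q, _, hq, hqp⟩ := exists_bot_lt_lt_of_one_lt_height hp
  have hbot : (⊥ : Ideal S).comap (algebraMap D S) = ⊥ :=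
    (RingHom.injective_iff_ker_eq_bot _).1 (FaithfulSMul.algebraMap_injective D S)
  obtain ⟨P, -, _, rfl⟩ := Ideal.exists_ideal_over_prime_of_isIntegral q (⊥ : Ideal S)
    (hbot.trans_le bot_le)
  obtain ⟨Q, hPQ, _, rfl⟩ := Ideal.exists_ideal_over_prime_of_isIntegral p P hqp.le
  have hQ : Q ∈ (Ideal.span {t}).minimalPrimes := by
    rw [← Ideal.radical_minimalPrimes, ← h, Ideal.radical_minimalPrimes]
    exact Ideal.IsIntegral.mem_minimalPrimes_map_under Q
  have hP : P = ⊥ := eq_bot_of_lt_of_mem_minimalPrimes_span_singleton hQ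
    (lt_of_le_of_ne hPQ (by rintro rfl; exact hqp.false))
  exact hq.ne' (hP ▸ hbot)

end Krull

section Integrality

open Polynomial

theorem comap_aeval_map_algebraMap {D S : Type*} [CommRing D] [CommRing S] [Algebra D S] {t : S}
    (ht : Function.Surjective (aeval (R := D) t)) {p : Ideal D}
    (h : RingHom.ker (aeval (R := D) t) ≤ p.map C) :
    (p.map (algebraMap D S)).comap (aeval (R := D) t) = p.map C := by
  have hC : algebraMap D S = (aeval (R := D) t : D[X] →+* S).comp C := by ext; simp
  rw [hC, ← Ideal.map_map, Ideal.map_coe, Ideal.comap_map_of_surjective _ ht]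
  exact sup_eq_left.2 h

theorem isPrime_map_algebraMap_of_ker_aeval_le {D S : Type*} [CommRing D] [CommRing S]
    [Algebra D S] {t : S} (ht : Function.Surjective (aeval (R := D) t)) {p : Ideal D} [p.IsPrime]
    (h : RingHom.ker (aeval (R := D) t) ≤ p.map C) : (p.map (algebraMap D S)).IsPrime := by
  rw [← Ideal.map_comap_of_surjective _ ht (p.map (algebraMap D S)),
    comap_aeval_map_algebraMap ht h]
  exact Ideal.map_isPrime_of_surjective ht h

theorem notMem_map_algebraMap_of_ker_aeval_le {D S : Type*} [CommRing D] [CommRing S]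
    [Algebra D S] {t : S} (ht : Function.Surjective (aeval (R := D) t)) {p : Ideal D} (hp : p ≠ ⊤)
    (h : RingHom.ker (aeval (R := D) t) ≤ p.map C) : t ∉ p.map (algebraMap D S) := fun htp => by
  have hX : X ∈ p.map (C : D →+* D[X]) := by
    rwa [← comap_aeval_map_algebraMap ht h, Ideal.mem_comap, aeval_X]
  exact (Ideal.ne_top_iff_one p).1 hp (coeff_X_one (R := D) ▸ Ideal.mem_map_C_iff.1 hX 1)

theorem radical_map_eq_radical_span_singleton_of_isDistinguishedAt {D S : Type*} [CommRing D]
    [CommRing S] [Algebra D S] {I : Ideal D} {t : S}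
    (h : I.map (algebraMap D S) ≤ (Ideal.span {t}).radical) {G : D[X]} (hG : G.IsDistinguishedAt I)
    (ht : aeval t G = 0) : (I.map (algebraMap D S)).radical = (Ideal.span {t}).radical := by
  refine le_antisymm (Ideal.radical_le_radical_iff.2 h)
    (Ideal.radical_le_radical_iff.2 ((Ideal.span_singleton_le_iff_mem _).2
      ⟨(G.map (algebraMap D S)).natDegree, ?_⟩))
  exact hG.pow_natDegree_le_of_aeval_zero_of_monic_mem_map ht hG.monic _ le_rfl

theorem isUnit_of_map_maximalIdeal_le_radical_span_singleton {D S : Type*} [CommRing D]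
    [IsDomain D] [IsLocalRing D] [IsNoetherianRing D] [IsAdicComplete (maximalIdeal D) D]
    (hD : 1 < (maximalIdeal D).height) [CommRing S] [IsDomain S] [Algebra D S] [FaithfulSMul D S]
    {t : S} (ht : Function.Surjective (aeval (R := D) t))
    (h : (maximalIdeal D).map (algebraMap D S) ≤ (Ideal.span {t}).radical) : IsUnit t := by
  by_contra hunit
  have : IsNoetherianRing S := isNoetherianRing_of_surjective _ _ (aeval (R := D) t).toRingHom ht
  by_cases hker : RingHom.ker (aeval (R := D) t) ≤ (maximalIdeal D).map C
  · have := isPrime_map_algebraMap_of_ker_aeval_le ht hker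
    refine notMem_map_algebraMap_of_ker_aeval_le ht Ideal.IsPrime.ne_top' hker
      (mem_of_le_radical_span_singleton (fun hbot => ?_) hunit h)
    rw [Ideal.map_eq_bot_iff_of_injective (FaithfulSMul.algebraMap_injective D S)] at hbot
    simp [hbot] at hD
  · obtain ⟨g, hg, hgm⟩ := SetLike.not_le_iff_exists.1 hker
    have hres : g.map (residue D) ≠ 0 := fun h0 => hgm <| by
      rwa [← Ideal.mk_ker (I := maximalIdeal D), ← Polynomial.ker_mapRingHom]
    obtain ⟨G, hG, hGt⟩ :=
      (isUnit_or_exists_isDistinguishedAt_of_aeval_eq_zero hres hg).resolve_left hunit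
    have hint : IsIntegral D t := ⟨G, hG.monic, hGt⟩
    have : Algebra.IsIntegral D S := ⟨fun s => by
      obtain ⟨f, rfl⟩ := ht s
      exact adjoin_le_integralClosure hint (aeval_mem_adjoin_singleton D t)⟩
    exact hD.not_ge (height_le_one_of_radical_map_eq_radical_span_singleton
      (radical_map_eq_radical_span_singleton_of_isDistinguishedAt h hG hGt))

theorem isIntegral_of_isUnit_adjoin_inv {D L : Type*} [CommRing D] [Nontrivial D] [Field L]
    [Algebra D L] {x : L} (hx : x ≠ 0)
    (h : IsUnit (⟨x⁻¹, Algebra.self_mem_adjoin_singleton D _⟩ : Algebra.adjoin D {x⁻¹})) :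
    IsIntegral D x := by
  have := invertibleOfNonzero (inv_ne_zero hx)
  obtain ⟨f, hf, hfx⟩ :=
    Algebra.exists_aeval_invOf_eq_zero_of_idealMap_adjoin_sup_span_eq_top (R := D) x⁻¹ ⊥ bot_ne_top
      (by rw [Ideal.map_bot, bot_sup_eq, Ideal.span_singleton_eq_top.2 h])
  rw [invOf_eq_inv, inv_inv] at hfx
  exact ⟨f, sub_eq_zero.1 hf, hfx⟩

theorem isIntegral_of_maximalIdeal_le_radical_denominatorIdeal_of_field {D L : Type*} [CommRing D]
    [IsDomain D] [IsLocalRing D] [IsNoetherianRing D] [IsAdicComplete (maximalIdeal D) D]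
    (hD : 1 < (maximalIdeal D).height) [Field L] [Algebra D L] [FaithfulSMul D L] {x : L}
    (hx : maximalIdeal D ≤ (denominatorIdeal D x).radical) : IsIntegral D x := by
  obtain rfl | hx0 := eq_or_ne x 0
  · exact isIntegral_zero
  have : FaithfulSMul D (Algebra.adjoin D {x⁻¹}) :=
    (faithfulSMul_iff_algebraMap_injective D _).2 fun a b h =>
      FaithfulSMul.algebraMap_injective D L (congrArg Subtype.val h)
  refine isIntegral_of_isUnit_adjoin_inv hx0
    (isUnit_of_map_maximalIdeal_le_radical_span_singleton hD (fun ⟨y, hy⟩ => ?_) ?_)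
  · obtain ⟨f, hf⟩ := Algebra.adjoin_eq_exists_aeval D x⁻¹ ⟨y, hy⟩
    exact ⟨f, Subtype.ext ((aeval_algHom_apply (Subalgebra.val _) _ f).symm.trans hf)⟩
  · rw [Ideal.map_le_iff_le_comap, Ideal.comap_radical]
    refine hx.trans (Ideal.radical_mono fun r hr => ?_)
    obtain ⟨a, ha⟩ := mem_denominatorIdeal.1 hr
    refine Ideal.mem_comap.2 (Ideal.mem_span_singleton.2 ⟨algebraMap D _ a, Subtype.ext ?_⟩)
    change algebraMap D L r = x⁻¹ * algebraMap D L a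
    rw [ha, Algebra.smul_def, mul_left_comm, inv_mul_cancel₀ hx0, mul_one]

end Integrality

section Completion

theorem isPrecomplete_of_surjective {R M N : Type*} [CommRing R] [AddCommGroup M] [Module R M]
    [AddCommGroup N] [Module R N] {I : Ideal R} [IsPrecomplete I M] {f : M →ₗ[R] N}
    (hf : Function.Surjective f) : IsPrecomplete I N := by
  rw [← AdicCompletion.of_surjective_iff]
  have hcomp : ⇑(AdicCompletion.of I N) ∘ f = AdicCompletion.map I f ∘ AdicCompletion.of I M :=
    funext fun x => (AdicCompletion.map_of I f x).symm
  refine .of_comp (g := f) (hcomp ▸ ?_)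
  exact (AdicCompletion.map_surjective I hf).comp
    (AdicCompletion.of_surjective_iff.2 inferInstance)

theorem isAdicComplete_maximalIdeal_of_surjective {A B : Type*} [CommRing A] [IsLocalRing A]
    [IsAdicComplete (maximalIdeal A) A] [CommRing B] [IsLocalRing B] [IsNoetherianRing B]
    [Algebra A B] (h : Function.Surjective (algebraMap A B)) :
    IsAdicComplete (maximalIdeal B) B := by
  have : IsPrecomplete (maximalIdeal A) B :=
    isPrecomplete_of_surjective (f := Algebra.linearMap A B) h
  have : IsPrecomplete (maximalIdeal B) B := by
    rwa [← map_maximalIdeal_of_surjective (algebraMap A B) h, IsPrecomplete.map_algebraMap_iff]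
  have : IsHausdorff (maximalIdeal B) B := .of_isLocalRing _ _ Ideal.IsPrime.ne_top'
  exact ⟨⟩

end Completion

section Components

open Polynomial

theorem isIntegral_of_forall_isIntegral_map {R K ι : Type*} {L : ι → Type*} [CommRing R]
    [CommRing K] [Algebra R K] [∀ i, CommRing (L i)] [∀ i, Algebra R (L i)] [Finite ι]
    (φ : ∀ i, K →ₐ[R] L i) (hφ : ∀ y, (∀ i, φ i y = 0) → y = 0) {x : K}
    (hx : ∀ i, IsIntegral R (φ i x)) : IsIntegral R x := by
  have := Fintype.ofFinite ι
  choose f hf hfx using hx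
  refine ⟨∏ i, f i, monic_prod_of_monic _ _ fun i _ => hf i, hφ _ fun i => ?_⟩
  rw [← aeval_def, ← aeval_algHom_apply, map_prod]
  exact Finset.prod_eq_zero (Finset.mem_univ i) (hfx i)

variable {R K : Type*} [CommRing R] [CommRing K] [Algebra R K] [IsFractionRing R K]

/-- The projection of the total ring of fractions of `R` onto the fraction field of the component
`R ⧸ p` cut out by a minimal prime `p`. -/
noncomputable def fractionRingProj (p : minimalPrimes R) : K →ₐ[R] FractionRing (R ⧸ p.1) :=
  have := Ideal.IsMinimalPrime.isPrime p.2
  IsLocalization.liftAlgHom (M := R⁰) (f := Algebra.ofId R (FractionRing (R ⧸ p.1))) fun s => by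
    rw [Algebra.ofId_apply, isUnit_iff_ne_zero, IsScalarTower.algebraMap_apply R (R ⧸ p.1),
      Ne, FaithfulSMul.algebraMap_eq_zero_iff, Ideal.Quotient.algebraMap_eq,
      Ideal.Quotient.eq_zero_iff_mem]
    exact fun hs => notMem_nonZeroDivisors_of_mem_mem_minimalPrimes hs p.2 s.2

theorem eq_zero_of_forall_fractionRingProj_eq_zero [IsReduced R] {x : K}
    (hx : ∀ p, fractionRingProj (R := R) p x = 0) : x = 0 := by
  obtain ⟨⟨a, s⟩, has⟩ := IsLocalization.surj R⁰ x
  have ha : a ∈ nilradical R := by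
    rw [nilradical, ← Ideal.sInf_minimalPrimes, Submodule.mem_sInf]
    intro p hp
    have := congrArg (fractionRingProj ⟨p, hp⟩) has
    have hpp := Ideal.IsMinimalPrime.isPrime hp
    rwa [map_mul, hx, zero_mul, AlgHom.commutes, IsScalarTower.algebraMap_apply R (R ⧸ p),
      eq_comm, FaithfulSMul.algebraMap_eq_zero_iff, Ideal.Quotient.algebraMap_eq,
      Ideal.Quotient.eq_zero_iff_mem] at this
  rw [nilradical_eq_zero] at ha
  rwa [ha, map_zero, (IsLocalization.map_units K s).mul_left_eq_zero] at has

theorem map_denominatorIdeal_le {R S K L : Type*} [CommRing R] [CommRing S] [CommRing K]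
    [CommRing L] [Algebra R S] [Algebra R K] [Algebra S L] [Algebra R L] [IsScalarTower R S L]
    (φ : K →ₐ[R] L) (x : K) :
    (denominatorIdeal R x).map (algebraMap R S) ≤ denominatorIdeal S (φ x) := by
  refine Ideal.map_le_iff_le_comap.2 fun r hr => ?_
  obtain ⟨a, ha⟩ := mem_denominatorIdeal.1 hr
  refine mem_denominatorIdeal.2 ⟨algebraMap R S a, ?_⟩
  rw [← IsScalarTower.algebraMap_apply, ← φ.commutes, ha, map_smul, algebraMap_smul]

theorem isIntegral_of_maximalIdeal_le_radical_denominatorIdeal [IsLocalRing R]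
    [IsNoetherianRing R] [IsReduced R] [IsAdicComplete (maximalIdeal R) R]
    (hR : ∀ p ∈ minimalPrimes R, 1 < ringKrullDim (R ⧸ p)) {x : K}
    (hx : maximalIdeal R ≤ (denominatorIdeal R x).radical) : IsIntegral R x := by
  have := (minimalPrimes.finite_of_isNoetherianRing R).to_subtype
  refine isIntegral_of_forall_isIntegral_map fractionRingProj
    (fun y => eq_zero_of_forall_fractionRingProj_eq_zero) fun p => ?_
  have := Ideal.IsMinimalPrime.isPrime p.2
  have hsurj : Function.Surjective (algebraMap R (R ⧸ p.1)) := Ideal.Quotient.mk_surjective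
  have : IsLocalRing (R ⧸ p.1) := .of_surjective' (algebraMap R (R ⧸ p.1)) hsurj
  have := isAdicComplete_maximalIdeal_of_surjective hsurj
  have hdim : 1 < (maximalIdeal (R ⧸ p.1)).height := by
    have := hR p.1 p.2
    rw [← maximalIdeal_height_eq_ringKrullDim] at this
    exact_mod_cast this
  refine isIntegral_trans (A := R ⧸ p.1) _
    (isIntegral_of_maximalIdeal_le_radical_denominatorIdeal_of_field hdim ?_)
  rw [← map_maximalIdeal_of_surjective _ hsurj]
  exact (Ideal.map_mono hx).trans ((Ideal.map_radical_le _).trans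
    (Ideal.radical_mono (map_denominatorIdeal_le _ x)))

end Components

section Regular

theorem mem_nonZeroDivisors_of_forall_notMem_minimalPrimes {R : Type*} [CommRing R] [IsReduced R]
    {s : R} (h : ∀ p ∈ minimalPrimes R, s ∉ p) : s ∈ R⁰ := by
  refine mem_nonZeroDivisors_iff_right.2 fun a ha => ?_
  have : a ∈ nilradical R := by
    rw [nilradical, ← Ideal.sInf_minimalPrimes, Submodule.mem_sInf]
    exact fun p hp => ((Ideal.IsMinimalPrime.isPrime hp).mem_or_mem
      (ha ▸ p.zero_mem : a * s ∈ p)).resolve_right (h p hp)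
  rwa [nilradical_eq_zero] at this

theorem exists_mem_nonZeroDivisors_of_forall_not_le_minimalPrimes {R : Type*} [CommRing R]
    [IsNoetherianRing R] [IsReduced R] {I : Ideal R} (h : ∀ p ∈ minimalPrimes R, ¬ I ≤ p) :
    ∃ s ∈ I, s ∈ R⁰ := by
  have hsub := (Ideal.subset_union_prime_finite (minimalPrimes.finite_of_isNoetherianRing R)
    (f := id) ⊥ ⊥ fun p hp _ _ => Ideal.IsMinimalPrime.isPrime hp).not.2
      fun ⟨p, hp, hle⟩ => h p hp hle
  obtain ⟨s, hs, hsp⟩ := Set.not_subset.1 hsub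
  exact ⟨s, hs, mem_nonZeroDivisors_of_forall_notMem_minimalPrimes fun p hp hs =>
    hsp (Set.mem_biUnion hp hs)⟩

theorem exists_mem_maximalIdeal_mem_nonZeroDivisors {R : Type*} [CommRing R] [IsLocalRing R]
    [IsNoetherianRing R] [IsReduced R] (hR : ∀ p ∈ minimalPrimes R, 0 < ringKrullDim (R ⧸ p)) :
    ∃ s ∈ maximalIdeal R, s ∈ R⁰ := by
  refine exists_mem_nonZeroDivisors_of_forall_not_le_minimalPrimes fun p hp hle => ?_
  have hpm : p.IsMaximal :=
    (maximalIdeal.isMaximal R).eq_of_le (Ideal.IsMinimalPrime.isPrime hp).ne_top hle ▸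
      maximalIdeal.isMaximal R
  exact (hR p hp).ne' (ringKrullDim_eq_zero_of_isField
    ((Ideal.Quotient.maximal_ideal_iff_isField_quotient p).1 hpm))

theorem IsSystemOfParameters.mem_nonZeroDivisors {R : Type*} [CommRing R] [IsLocalRing R]
    [IsNoetherianRing R] [IsReduced R] (hequi : IsEquidimensionalRing R) {d : ℕ} {x : Fin d → R}
    (hx : IsSystemOfParameters R x) (i : Fin d) : x i ∈ R⁰ := by
  refine mem_nonZeroDivisors_of_forall_notMem_minimalPrimes fun p hp hxp => ?_
  have := Ideal.IsMinimalPrime.isPrime hp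
  have hsurj : Function.Surjective (Ideal.Quotient.mk p) := Ideal.Quotient.mk_surjective
  have : IsLocalRing (R ⧸ p) := .of_surjective' _ hsurj
  -- Modulo `p`, the parameters other than `x i` still generate an `𝔪`-primary ideal.
  let s : Set (R ⧸ p) := (Ideal.Quotient.mk p ∘ x) '' {i}ᶜ
  have hmin : maximalIdeal (R ⧸ p) ∈ (Ideal.span s).minimalPrimes := by
    refine ⟨⟨inferInstance, ?_⟩, fun Q ⟨hQ, hsQ⟩ _ => ?_⟩ <;>
      rw [← map_maximalIdeal_of_surjective _ hsurj]
    · rw [Ideal.span_le]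
      rintro _ ⟨j, -, rfl⟩
      exact Ideal.mem_map_of_mem _ (hx.2.le (Ideal.le_radical (Ideal.subset_span ⟨j, rfl⟩)))
    · rw [Ideal.map_le_iff_le_comap, ← hx.2, (hQ.comap _).radical_le_iff, Ideal.span_le]
      rintro _ ⟨j, rfl⟩
      obtain rfl | hj := eq_or_ne j i
      · exact Ideal.mem_comap.2 (Ideal.Quotient.eq_zero_iff_mem.2 hxp ▸ Q.zero_mem)
      · exact hsQ (Ideal.subset_span ⟨j, hj, rfl⟩)
  have hdim : (maximalIdeal (R ⧸ p)).height = d := WithBot.coe_injective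
    ((maximalIdeal_height_eq_ringKrullDim (R := R ⧸ p)).trans ((hequi p hp).trans hx.1))
  have hlt : s.ncard < d := calc
    s.ncard ≤ ({i}ᶜ : Set (Fin d)).ncard := Set.ncard_image_le
    _ < (Set.univ : Set (Fin d)).ncard := Set.ncard_lt_ncard (Set.ssubset_univ_iff.2 (by simp))
    _ = d := by simp
  have hle := Ideal.height_le_card_of_mem_minimalPrimes_span s.toFinite hmin
  rw [hdim, Nat.cast_le] at hle
  exact hlt.not_ge hle

theorem isPrincipal_maximalIdeal_of_ringKrullDim_le_one {A : Type*} [CommRing A]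
    [IsRegularLocalRing A] (h : ringKrullDim A ≤ 1) : (maximalIdeal A).IsPrincipal := by
  rw [← (IsRegularLocalRing.iff_finrank_cotangentSpace A).1 ‹_›] at h
  exact finrank_cotangentSpace_le_one_iff.1 (by exact_mod_cast h)

theorem isDomain_of_ringKrullDim_le_one {A : Type*} [CommRing A] [IsRegularLocalRing A]
    (h : ringKrullDim A ≤ 1) : IsDomain A := by
  obtain ⟨ϖ, hϖ⟩ := isPrincipal_maximalIdeal_of_ringKrullDim_le_one h
  rw [Ideal.submodule_span_eq] at hϖ
  obtain ⟨p, hp⟩ := Ideal.nonempty_minimalPrimes (I := (⊥ : Ideal A)) bot_ne_top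
  have := hp.isPrime
  by_cases hϖp : ϖ ∈ p
  · have hpm : p = maximalIdeal A := (le_maximalIdeal this.ne_top).antisymm
      (hϖ ▸ (Ideal.span_singleton_le_iff_mem _).2 hϖp)
    have hdim := maximalIdeal_height_eq_ringKrullDim (R := A)
    rw [← hpm, Ideal.height_eq_zero_iff.2 hp,
      ← (IsRegularLocalRing.iff_finrank_cotangentSpace A).1 ‹_›] at hdim
    exact (finrank_cotangentSpace_eq_zero_iff.1 (by exact_mod_cast hdim.symm)).isDomain
  · have hbot : p = ⊥ := by
      refine Submodule.eq_bot_of_le_smul_of_le_jacobson_bot (maximalIdeal A) p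
        (IsNoetherian.noetherian _) (fun a ha => ?_) (maximalIdeal_le_jacobson _)
      obtain ⟨b, rfl⟩ := Ideal.mem_span_singleton'.1 (hϖ ▸ le_maximalIdeal this.ne_top ha)
      rw [mul_comm]
      exact Submodule.smul_mem_smul (hϖ ▸ Ideal.mem_span_singleton_self ϖ)
        ((this.mem_or_mem ha).resolve_right hϖp)
    exact IsDomain.of_bot_isPrime A (hbp := hbot ▸ this)

theorem isIntegrallyClosed_of_ringKrullDim_le_one {A : Type*} [CommRing A] [IsRegularLocalRing A]
    (h : ringKrullDim A ≤ 1) : IsIntegrallyClosed A := by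
  have := isDomain_of_ringKrullDim_le_one h
  have htfae := (tfae_of_isNoetherianRing_of_isLocalRing_of_isDomain A).out 4 3
  exact (htfae.1 (isPrincipal_maximalIdeal_of_ringKrullDim_le_one h)).1

theorem exists_notMem_smul_eq_zero_of_map_eq_zero {R K F : Type*} [CommRing R] [CommRing K]
    [Algebra R K] [IsFractionRing R K] (p : Ideal R) [p.IsPrime] [CommRing F] [Algebra R F]
    [Algebra (Localization.AtPrime p) F] [IsScalarTower R (Localization.AtPrime p) F]
    [FaithfulSMul (Localization.AtPrime p) F] (φ : K →ₐ[R] F) {y : K} (hy : φ y = 0) :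
    ∃ t ∉ p, t • y = 0 := by
  obtain ⟨⟨a, b⟩, hab⟩ := IsLocalization.surj R⁰ y
  have ha : algebraMap R (Localization.AtPrime p) a = 0 := by
    rw [← FaithfulSMul.algebraMap_eq_zero_iff (Localization.AtPrime p) F,
      ← IsScalarTower.algebraMap_apply, ← φ.commutes, ← hab, map_mul, hy, zero_mul]
  obtain ⟨⟨t, ht⟩, hta⟩ := (IsLocalization.map_eq_zero_iff p.primeCompl _ _).1 ha
  refine ⟨t, ht, (IsLocalization.map_units K b).mul_left_eq_zero.1 ?_⟩
  rw [smul_mul_assoc, hab, Algebra.smul_def, ← map_mul, hta, map_zero]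

theorem not_denominatorIdeal_le_of_isIntegral {R K : Type*} [CommRing R] [CommRing K] [Algebra R K]
    [IsFractionRing R K] {x : K} (hx : IsIntegral R x) (p : Ideal R) [p.IsPrime]
    [IsDomain (Localization.AtPrime p)] [IsIntegrallyClosed (Localization.AtPrime p)] :
    ¬ denominatorIdeal R x ≤ p := by
  let F := FractionRing (Localization.AtPrime p)
  have hunit (b : R⁰) : IsUnit (Algebra.ofId R F b) := by
    rw [Algebra.ofId_apply, isUnit_iff_ne_zero,
      IsScalarTower.algebraMap_apply R (Localization.AtPrime p), Ne,
      FaithfulSMul.algebraMap_eq_zero_iff, IsLocalization.map_eq_zero_iff p.primeCompl]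
    rintro ⟨⟨t, ht⟩, htb⟩
    obtain rfl : t = 0 := (mul_right_mem_nonZeroDivisors_eq_zero_iff b.2).1 htb
    exact ht p.zero_mem
  let φ : K →ₐ[R] F := IsLocalization.liftAlgHom (M := R⁰) (f := Algebra.ofId R F) hunit
  have hφx : IsIntegral (Localization.AtPrime p) (φ x) := (hx.map φ).tower_top
  obtain ⟨α, hα⟩ := IsIntegrallyClosed.isIntegral_iff.1 hφx
  obtain ⟨⟨c, ⟨s, hs⟩⟩, hcs⟩ := IsLocalization.surj p.primeCompl α
  have hφ : φ (s • x - algebraMap R K c) = 0 := by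
    rw [map_sub, map_smul, φ.commutes, IsScalarTower.algebraMap_apply R (Localization.AtPrime p),
      ← hcs, map_mul, hα, ← IsScalarTower.algebraMap_apply, mul_comm, ← Algebra.smul_def, sub_self]
  obtain ⟨t, ht, htx⟩ := exists_notMem_smul_eq_zero_of_map_eq_zero p φ hφ
  rw [smul_sub, sub_eq_zero, smul_smul] at htx
  refine fun hle => p.primeCompl.mul_mem ht hs (hle (mem_denominatorIdeal.2 ⟨t * c, ?_⟩))
  rw [htx, map_mul, Algebra.smul_def]

theorem maximalIdeal_le_radical_denominatorIdeal {R K : Type*} [CommRing R] [IsLocalRing R]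
    [CommRing K] [Algebra R K] [IsFractionRing R K]
    (hdim : ringKrullDim R ≤ 2) (hR1 : SatisfiesSerreR R 1) {x : K} (hx : IsIntegral R x) :
    maximalIdeal R ≤ (denominatorIdeal R x).radical := by
  rw [Ideal.radical_eq_sInf]
  refine le_sInf fun p ⟨hxp, hp⟩ => ?_
  by_contra hne
  have hlt : p < maximalIdeal R := lt_of_le_not_ge (le_maximalIdeal hp.ne_top) hne
  have hht : p.height ≤ 1 := by
    rw [← maximalIdeal_height_eq_ringKrullDim] at hdim
    have h2 : (maximalIdeal R).height ≤ 1 + 1 := by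
      rw [one_add_one_eq_two]
      exact WithBot.coe_le_coe.1 hdim
    exact (ENat.add_le_add_iff_right ENat.one_ne_top).1
      ((Ideal.height_add_one_le_of_lt_of_isPrime hlt).trans h2)
  have := hR1 p hht
  have hdimp : ringKrullDim (Localization.AtPrime p) ≤ 1 := by
    rw [IsLocalization.AtPrime.ringKrullDim_eq_height p]
    exact_mod_cast hht
  have := isDomain_of_ringKrullDim_le_one hdimp
  have := isIntegrallyClosed_of_ringKrullDim_le_one hdimp
  exact not_denominatorIdeal_le_of_isIntegral hx p hxp

end Regular

section Seminormal

theorem le_radical_colon_of_fg {R K : Type*} [CommRing R] [CommRing K] [Algebra R K]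
    {I : Ideal R} {M : Submodule R K} (hM : M.FG)
    (h : ∀ y ∈ M, I ≤ (denominatorIdeal R y).radical) :
    I ≤ ((1 : Submodule R K).colon (M : Set K)).radical := by
  obtain ⟨T, rfl⟩ := hM
  have hcolon : (1 : Submodule R K).colon (T : Set K) = T.inf (denominatorIdeal R) := by
    ext r
    simp [Finset.inf_eq_iInf, denominatorIdeal, Submodule.mem_colon]
  rw [Submodule.colon_span, hcolon, ← Ideal.radicalInfTopHom_apply, map_finset_inf]
  exact Finset.le_inf fun y hy => h y (Submodule.subset_span hy)

theorem IsSeminormalRing.exists_algebraMap_eq_of_sq_of_cube {R K : Type*} [CommRing R] [CommRing K]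
    [Algebra R K] [FaithfulSMul R K] [IsReduced K] (hsn : IsSeminormalRing R) {y : K} {b c : R}
    (hb : algebraMap R K b = y ^ 2) (hc : algebraMap R K c = y ^ 3) :
    ∃ a, algebraMap R K a = y := by
  obtain ⟨a, rfl, rfl⟩ := hsn b c (FaithfulSMul.algebraMap_injective R K (by
    rw [map_pow, map_pow, hb, hc]
    ring))
  refine ⟨a, sub_eq_zero.1 (eq_zero_of_pow_eq_zero (n := 3) ?_)⟩
  rw [map_pow] at hb hc
  linear_combination -(3 * y + 3 * algebraMap R K a) * hb + 4 * hc

theorem IsSeminormalRing.exists_algebraMap_eq_of_forall_pow {R K : Type*} [CommRing R] [CommRing K]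
    [Algebra R K] [FaithfulSMul R K] [IsReduced K] (hsn : IsSeminormalRing R) {y : K} (N : ℕ)
    (h : ∀ n ≥ N, ∃ a, algebraMap R K a = y ^ n) : ∃ a, algebraMap R K a = y := by
  induction N with
  | zero => simpa using h 1 zero_le_one
  | succ N ih =>
    obtain rfl | hN := N.eq_zero_or_pos
    · simpa using h 1 le_rfl
    · refine ih fun n hn => ?_
      obtain ⟨b, hb⟩ := h (n * 2) (by lia)
      obtain ⟨c, hc⟩ := h (n * 3) (by lia)
      exact hsn.exists_algebraMap_eq_of_sq_of_cube (hb.trans (pow_mul y n 2))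
        (hc.trans (pow_mul y n 3))

theorem IsSeminormalRing.maximalIdeal_le_denominatorIdeal {R K : Type*} [CommRing R]
    [IsLocalRing R] [CommRing K] [Algebra R K] [IsFractionRing R K]
    (hsn : IsSeminormalRing R) (hdim : ringKrullDim R ≤ 2) (hR1 : SatisfiesSerreR R 1) {x : K}
    (hx : IsIntegral R x) : maximalIdeal R ≤ denominatorIdeal R x := by
  intro r hr
  have := hsn.isReduced
  have : IsReduced K :=
    isReduced_of_injective _ (IsLocalization.algEquiv R⁰ K (FractionRing R)).injective
  have hrad := le_radical_colon_of_fg hx.fg_adjoin_singleton fun y hy =>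
    maximalIdeal_le_radical_denominatorIdeal hdim hR1
      (adjoin_le_integralClosure hx hy)
  obtain ⟨N, hN⟩ := hrad hr
  obtain ⟨a, ha⟩ := hsn.exists_algebraMap_eq_of_forall_pow (y := r • x) N fun n hn => by
    have hrn := Ideal.pow_mem_of_pow_mem _ hN hn
    obtain ⟨a, ha⟩ := Submodule.mem_one.1 (Submodule.mem_colon.1 hrn (x ^ n)
      (pow_mem (Algebra.self_mem_adjoin_singleton R x) n))
    exact ⟨a, by rw [ha, smul_pow]⟩
  exact mem_denominatorIdeal.2 ⟨a, ha⟩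

theorem mem_conductorIdeal {R : Type*} [CommRing R] {r : R} :
    r ∈ conductorIdeal R ↔
      ∀ x : FractionRing R, IsIntegral R x → r ∈ denominatorIdeal R x := by
  simp_rw [conductorIdeal, Module.mem_annihilator, (Submodule.Quotient.mk_surjective _).forall,
    ← Submodule.Quotient.mk_smul, Submodule.Quotient.mk_eq_zero, mem_denominatorIdeal]
  refine ⟨fun h x hx => ?_, fun h x => ?_⟩
  · obtain ⟨s, hs⟩ := h ⟨x, hx⟩
    exact ⟨s, congrArg Subtype.val hs⟩
  · obtain ⟨s, hs⟩ := h x x.2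
    exact ⟨s, Subtype.ext hs⟩

theorem IsSeminormalRing.conductorIdeal_eq_maximalIdeal {R : Type*} [CommRing R]
    [IsLocalRing R] (hsn : IsSeminormalRing R) (hdim : ringKrullDim R ≤ 2)
    (hR1 : SatisfiesSerreR R 1) (hR : ¬ IsIntegrallyClosedIn R (FractionRing R)) :
    conductorIdeal R = maximalIdeal R := by
  refine (le_maximalIdeal fun htop => hR ?_).antisymm fun r hr =>
    mem_conductorIdeal.2 fun x hx => hsn.maximalIdeal_le_denominatorIdeal hdim hR1 hx hr
  refine isIntegrallyClosedIn_iff.2 ⟨IsFractionRing.injective _ _, fun {x} hx => ?_⟩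
  obtain ⟨a, ha⟩ := mem_denominatorIdeal.1
    (mem_conductorIdeal.1 ((Ideal.eq_top_iff_one _).1 htop) x hx)
  exact ⟨a, by rw [ha, one_smul]⟩

end Seminormal

section Buchsbaum

theorem exists_span_pair_le_denominatorIdeal {R K : Type*} [CommRing R] [CommRing K] [Algebra R K]
    [IsFractionRing R K] {x y a : R} (hx : x ∈ R⁰) (h : a * y ∈ Ideal.span {x}) :
    ∃ z : K, x • z = algebraMap R K a ∧ Ideal.span {x, y} ≤ denominatorIdeal R z := by
  obtain ⟨c, hc⟩ := Ideal.mem_span_singleton'.1 h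
  have hz : x • IsLocalization.mk' K a ⟨x, hx⟩ = algebraMap R K a :=
    (Algebra.smul_def _ _).trans (IsLocalization.mk'_spec' K a ⟨x, hx⟩)
  refine ⟨_, hz, (Ideal.span_le).2 (Set.pair_subset (mem_denominatorIdeal.2 ⟨a, hz.symm⟩)
    (mem_denominatorIdeal.2 ⟨c, ?_⟩))⟩
  refine (IsLocalization.map_units K (⟨x, hx⟩ : R⁰)).mul_right_injective ?_
  dsimp only
  rw [← Algebra.smul_def, ← Algebra.smul_def, smul_comm, hz, Algebra.smul_def, Algebra.smul_def,
    ← map_mul, ← map_mul, mul_comm x, hc, mul_comm]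

variable {R : Type*} [CommRing R] [IsLocalRing R] [IsNoetherianRing R]
  [IsAdicComplete (maximalIdeal R) R]

theorem IsSeminormalRing.mul_mem_span_singleton (hsn : IsSeminormalRing R)
    (hdim : ringKrullDim R ≤ 2) (hR : ∀ p ∈ minimalPrimes R, 1 < ringKrullDim (R ⧸ p))
    (hR1 : SatisfiesSerreR R 1) {x y a r : R} (hx : x ∈ R⁰)
    (hxy : maximalIdeal R ≤ (Ideal.span {x, y}).radical) (ha : a * y ∈ Ideal.span {x})
    (hr : r ∈ maximalIdeal R) : r * a ∈ Ideal.span {x} := by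
  have := hsn.isReduced
  obtain ⟨z, hz, hle⟩ := exists_span_pair_le_denominatorIdeal (K := FractionRing R) hx ha
  have hint : IsIntegral R z := isIntegral_of_maximalIdeal_le_radical_denominatorIdeal hR
    (hxy.trans (Ideal.radical_mono hle))
  obtain ⟨b, hb⟩ :=
    mem_denominatorIdeal.1 (hsn.maximalIdeal_le_denominatorIdeal hdim hR1 hint hr)
  refine Ideal.mem_span_singleton'.2 ⟨b, IsFractionRing.injective R (FractionRing R) ?_⟩
  rw [map_mul, map_mul, hb, ← hz, mul_comm, ← Algebra.smul_def, ← Algebra.smul_def, smul_comm]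

theorem IsSeminormalRing.isBuchsbaumRing (hsn : IsSeminormalRing R) (hdim : ringKrullDim R = 2)
    (hequi : IsEquidimensionalRing R) (hR1 : SatisfiesSerreR R 1) : IsBuchsbaumRing R := by
  intro d x hx i a ha r hr
  have := hsn.isReduced
  obtain rfl : d = 2 := by exact_mod_cast hx.1.symm.trans hdim
  have hreg := hx.mem_nonZeroDivisors hequi
  fin_cases i
  · have hIio : Set.Iio (0 : Fin 2) = ∅ := Set.Iio_bot
    simp only [Fin.zero_eta, hIio, Set.image_empty, Ideal.span_empty, Ideal.mem_bot] at ha ⊢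
    rw [(mul_right_mem_nonZeroDivisors_eq_zero_iff (hreg 0)).1 ha, mul_zero]
  · have hIio : Set.Iio (1 : Fin 2) = {0} := by
      ext j
      simp [Fin.lt_one_iff]
    have hrange : Set.range x = {x 0, x 1} := by
      ext
      simp [Fin.exists_fin_two, eq_comm]
    simp only [Fin.mk_one, hIio, Set.image_singleton] at ha ⊢
    refine hsn.mul_mem_span_singleton hdim.le (fun p hp => ?_) hR1 (hreg 0)
      (hrange ▸ hx.2.ge) ha hr
    rw [hequi p hp, hdim]
    exact Nat.one_lt_ofNat

end Buchsbaum

section ExtOne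

open CategoryTheory Opposite

section Linear

variable {A : Type*} [Category* A] [Abelian A] {R : Type*} [Ring R] [Linear R A]

/-- The map of complexes `Hom(L, Y) ⟶ Hom(K, Y)` induced by a map of chain complexes `K ⟶ L`. -/
noncomputable def linearYonedaObjMap (R : Type*) [Ring R] [Linear R A] {K L : ChainComplex A ℕ}
    (φ : K ⟶ L) (Y : A) : L.linearYonedaObj R Y ⟶ K.linearYonedaObj R Y :=
  (HomologicalComplex.unopFunctor _ _).map
    ((((linearYoneda R A).obj Y).rightOp.mapHomologicalComplex _).map φ).op

variable [EnoughProjectives A]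

theorem isoExt_hom_naturality {X X' : A} (f : X ⟶ X') (P : ProjectiveResolution X)
    (Q : ProjectiveResolution X') (φ : P.complex ⟶ Q.complex)
    (comm : φ.f 0 ≫ Q.π.f 0 = P.π.f 0 ≫ f) (n : ℕ) (Y : A) :
    (((Ext R A n).map f.op).app Y) ≫ (P.isoExt n Y).hom =
      (Q.isoExt n Y).hom ≫ HomologicalComplex.homologyMap (linearYonedaObjMap R φ Y) n := by
  have h1 := congrArg Quiver.Hom.unop
    (P.isoLeftDerivedObj_inv_naturality f Q φ comm ((linearYoneda R A).obj Y).rightOp n)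
  have h2 := congrArg Quiver.Hom.unop (ShortComplex.homologyOpIso_inv_naturality
    ((HomologicalComplex.shortComplexFunctor _ _ n).map (linearYonedaObjMap R φ Y)))
  exact ((Category.assoc _ _ _).symm.trans (congrArg
    (· ≫ ((P.complex.linearYonedaObj R Y).homologyOp n).inv.unop) h1)).trans
    ((Category.assoc _ _ _).trans ((congrArg ((Q.isoLeftDerivedObj
      ((linearYoneda R A).obj Y).rightOp n).inv.unop ≫ ·) h2.symm).trans
      (Category.assoc _ _ _).symm))

variable {X : A} (P : ProjectiveResolution X) {Y : A}

/-- The morphism `w : P₁ ⟶ Y` is a cocycle of `Hom(P, Y)` whose class in `Ext¹(X, Y)`, computed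
by the projective resolution `P` of `X`, is `e`. -/
def RepresentsExtOne (w : P.complex.X 1 ⟶ Y) (e : ((Ext R A 1).obj (op X)).obj Y) : Prop :=
  ∃ z : (P.complex.linearYonedaObj R Y).cycles 1,
    (P.complex.linearYonedaObj R Y).iCycles 1 z = w ∧
      (P.complex.linearYonedaObj R Y).homologyπ 1 z = (P.isoExt 1 Y).hom e

theorem exists_representsExtOne (e : ((Ext R A 1).obj (op X)).obj Y) :
    ∃ w : P.complex.X 1 ⟶ Y, RepresentsExtOne P w e := by
  obtain ⟨z, hz⟩ := (ModuleCat.epi_iff_surjective _).1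
    (inferInstance : Epi ((P.complex.linearYonedaObj R Y).homologyπ 1)) ((P.isoExt 1 Y).hom e)
  exact ⟨_, z, rfl, hz⟩

variable {P}

variable (R) in
theorem exists_representsExtOne_of_d_comp {w : P.complex.X 1 ⟶ Y}
    (hw : P.complex.d 2 1 ≫ w = 0) :
    ∃ e : ((Ext R A 1).obj (op X)).obj Y, RepresentsExtOne P w e := by
  have hex := ShortComplex.exact_of_f_is_kernel
    (ShortComplex.mk _ _ ((P.complex.linearYonedaObj R Y).iCycles_d 1 2))
    ((P.complex.linearYonedaObj R Y).cyclesIsKernel 1 2 (by simp))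
  obtain ⟨z, hz⟩ := (ShortComplex.moduleCat_exact_iff _).1 hex w hw
  refine ⟨(P.isoExt 1 Y).inv ((P.complex.linearYonedaObj R Y).homologyπ 1 z), z, hz, ?_⟩
  exact (ConcreteCategory.congr_hom (P.isoExt 1 Y).inv_hom_id _).symm

namespace RepresentsExtOne

theorem d_comp {w : P.complex.X 1 ⟶ Y} {e : ((Ext R A 1).obj (op X)).obj Y}
    (h : RepresentsExtOne P w e) : P.complex.d 2 1 ≫ w = 0 := by
  obtain ⟨z, rfl, -⟩ := h
  exact ConcreteCategory.congr_hom ((P.complex.linearYonedaObj R Y).iCycles_d 1 2) z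

theorem exists_d_comp_eq {w : P.complex.X 1 ⟶ Y}
    (h : RepresentsExtOne P w (0 : ((Ext R A 1).obj (op X)).obj Y)) :
    ∃ v : P.complex.X 0 ⟶ Y, P.complex.d 1 0 ≫ v = w := by
  obtain ⟨z, rfl, hz⟩ := h
  rw [map_zero] at hz
  have hex := ShortComplex.exact_of_g_is_cokernel
    (ShortComplex.mk _ _ ((P.complex.linearYonedaObj R Y).toCycles_comp_homologyπ 0 1))
    ((P.complex.linearYonedaObj R Y).homologyIsCokernel 0 1 (by simp))
  obtain ⟨v, rfl⟩ := (ShortComplex.moduleCat_exact_iff _).1 hex z hz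
  exact ⟨v, (ConcreteCategory.congr_hom ((P.complex.linearYonedaObj R Y).toCycles_i 0 1) v).symm⟩

theorem eq_zero {v : P.complex.X 0 ⟶ Y} {e : ((Ext R A 1).obj (op X)).obj Y}
    (h : RepresentsExtOne P (P.complex.d 1 0 ≫ v) e) : e = 0 := by
  obtain ⟨z, hz, he⟩ := h
  have hvz : (P.complex.linearYonedaObj R Y).toCycles 0 1 v = z := by
    apply (ModuleCat.mono_iff_injective _).1
      (inferInstance : Mono ((P.complex.linearYonedaObj R Y).iCycles 1))
    rw [hz]
    exact ConcreteCategory.congr_hom ((P.complex.linearYonedaObj R Y).toCycles_i 0 1) v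
  have h0 : (P.isoExt 1 Y).hom e = 0 := by
    rw [← he, ← hvz]
    exact ConcreteCategory.congr_hom
      ((P.complex.linearYonedaObj R Y).toCycles_comp_homologyπ 0 1) v
  exact (ConcreteCategory.congr_hom (P.isoExt 1 Y).hom_inv_id e).symm.trans
    ((congrArg (P.isoExt 1 Y).inv h0).trans (map_zero _))

theorem smul {R : Type*} [CommRing R] [Linear R A] {w : P.complex.X 1 ⟶ Y}
    {e : ((Ext R A 1).obj (op X)).obj Y} (h : RepresentsExtOne P w e) (r : R) :
    RepresentsExtOne P (r • w) (r • e) := by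
  obtain ⟨z, rfl, hz⟩ := h
  exact ⟨r • z, map_smul _ _ _, by rw [map_smul, map_smul, hz]⟩

theorem map {X' : A} {Q : ProjectiveResolution X'} {f : X ⟶ X'} {φ : P.complex ⟶ Q.complex}
    (comm : φ.f 0 ≫ Q.π.f 0 = P.π.f 0 ≫ f) {w : Q.complex.X 1 ⟶ Y}
    {e : ((Ext R A 1).obj (op X')).obj Y} (h : RepresentsExtOne Q w e) :
    RepresentsExtOne P (φ.f 1 ≫ w) (((Ext R A 1).map f.op).app Y e) := by
  obtain ⟨z, rfl, hz⟩ := h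
  refine ⟨HomologicalComplex.cyclesMap (linearYonedaObjMap R φ Y) 1 z, ?_, ?_⟩
  · exact ConcreteCategory.congr_hom
      (HomologicalComplex.cyclesMap_i (linearYonedaObjMap R φ Y) 1) z
  · refine (ConcreteCategory.congr_hom
      (HomologicalComplex.homologyπ_naturality (linearYonedaObjMap R φ Y) 1) z).symm.trans ?_
    refine (congrArg (HomologicalComplex.homologyMap (linearYonedaObjMap R φ Y) 1) hz).trans ?_
    exact (ConcreteCategory.congr_hom (isoExt_hom_naturality f P Q φ comm 1 Y) e).symm

end RepresentsExtOne

end Linear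

section Fractions

universe u

variable {R : Type u} [CommRing R] {X : ModuleCat.{u} R} (P : ProjectiveResolution X)

theorem exists_d_comp_eq_smul_id {s : R} (hs : s ∈ Module.annihilator R X) :
    ∃ σ : P.complex.X 0 ⟶ P.complex.X 1, σ ≫ P.complex.d 1 0 = s • 𝟙 _ := by
  have hsπ : (s • 𝟙 (P.complex.X 0)) ≫ P.π.f 0 = 0 := by
    ext q
    exact (map_smul (P.π.f 0).hom s q).trans (Module.mem_annihilator.1 hs _)
  exact ⟨P.exact₀.liftFromProjective _ hsπ, P.exact₀.liftFromProjective_comp _ hsπ⟩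

theorem exists_d_apply_eq_smul {s : R} (hs : s ∈ Module.annihilator R X) (q : P.complex.X 0) :
    ∃ p, P.complex.d 1 0 p = s • q := by
  obtain ⟨σ, hσ⟩ := exists_d_comp_eq_smul_id P hs
  exact ⟨σ q, ConcreteCategory.congr_hom hσ q⟩

variable {P}

theorem apply_eq_of_d_apply_eq {Y : ModuleCat.{u} R} {w : P.complex.X 1 ⟶ Y}
    (hw : P.complex.d 2 1 ≫ w = 0) {p p' : P.complex.X 1}
    (hp : P.complex.d 1 0 p = P.complex.d 1 0 p') : w p = w p' := by
  obtain ⟨t, ht⟩ := (ShortComplex.moduleCat_exact_iff _).1 (P.exact_succ 0) (p - p')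
    (by rw [map_sub, sub_eq_zero]; exact hp)
  rw [← sub_eq_zero, ← map_sub, ← ht]
  exact ConcreteCategory.congr_hom hw t

variable {K : Type*} [CommRing K] [Algebra R K]

/-- The `K`-valued cochain `h` on `P₀` has an `R`-valued coboundary, which represents the class `e`.
When `K` is the total ring of fractions of `R` and `X` is torsion, so that `Ext¹(X, R)` is
`Hom(X, K / R)`, this says that the homomorphism `X → K / R` corresponding to `e` is induced
by `h`. -/
def FracRepresentsExtOne (P : ProjectiveResolution X) (h : P.complex.X 0 →ₗ[R] K)
    (e : ((Ext R (ModuleCat.{u} R) 1).obj (op X)).obj (ModuleCat.of R R)) : Prop :=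
  ∃ w : P.complex.X 1 ⟶ ModuleCat.of R R,
    RepresentsExtOne P w e ∧ ∀ p, algebraMap R K (w p) = h (P.complex.d 1 0 p)

variable {e : ((Ext R (ModuleCat.{u} R) 1).obj (op X)).obj (ModuleCat.of R R)}
  {h : P.complex.X 0 →ₗ[R] K}

theorem exists_linearMap_of_forall_exists_algebraMap_eq
    (hinj : Function.Injective (algebraMap R K)) {M : Type*} [AddCommGroup M] [Module R M]
    {h : M →ₗ[R] K} (hh : ∀ q, ∃ b, algebraMap R K b = h q) :
    ∃ v : M →ₗ[R] R, ∀ q, algebraMap R K (v q) = h q := by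
  let ι := LinearEquiv.ofInjective (Algebra.linearMap R K) hinj
  refine ⟨ι.symm.toLinearMap ∘ₗ h.codRestrict _ hh, fun q => ?_⟩
  exact congrArg Subtype.val (ι.apply_symm_apply ⟨h q, hh q⟩)

theorem exists_fracRepresentsExtOne [IsFractionRing R K] {s : R}
    (hsX : s ∈ Module.annihilator R X) (hs : s ∈ R⁰)
    (e : ((Ext R (ModuleCat.{u} R) 1).obj (op X)).obj (ModuleCat.of R R)) :
    ∃ h : P.complex.X 0 →ₗ[R] K, FracRepresentsExtOne P h e := by
  obtain ⟨w, hw⟩ := exists_representsExtOne P e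
  obtain ⟨σ, hσ⟩ := exists_d_comp_eq_smul_id P hsX
  have hwσ (p : P.complex.X 1) : w (σ (P.complex.d 1 0 p)) = s • w p := by
    rw [← map_smul]
    refine apply_eq_of_d_apply_eq hw.d_comp ?_
    rw [map_smul]
    exact ConcreteCategory.congr_hom hσ _
  let sInv : K := IsLocalization.mk' K 1 (⟨s, hs⟩ : R⁰)
  have hsInv : sInv * algebraMap R K s = 1 :=
    (IsLocalization.mk'_spec K 1 (⟨s, hs⟩ : R⁰)).trans (map_one _)
  refine ⟨LinearMap.mulLeft R sInv ∘ₗ Algebra.linearMap R K ∘ₗ (σ ≫ w).hom, w, hw, fun p => ?_⟩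
  change _ = sInv * algebraMap R K (w (σ (P.complex.d 1 0 p)))
  rw [hwσ, smul_eq_mul, map_mul, ← mul_assoc, hsInv, one_mul]

theorem exists_fracRepresentsExtOne_of_forall (hinj : Function.Injective (algebraMap R K))
    (hh : ∀ p, ∃ b, algebraMap R K b = h (P.complex.d 1 0 p)) :
    ∃ e, FracRepresentsExtOne P h e := by
  obtain ⟨w, hw⟩ := exists_linearMap_of_forall_exists_algebraMap_eq hinj
    (h := h ∘ₗ (P.complex.d 1 0).hom) hh
  obtain ⟨e, he⟩ := exists_representsExtOne_of_d_comp R (P := P) (w := ModuleCat.ofHom w) (by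
    ext t
    refine hinj ((hw _).trans ?_)
    have hdd : P.complex.d 1 0 (P.complex.d 2 1 t) = 0 :=
      ConcreteCategory.congr_hom (P.complex.d_comp_d 2 1 0) t
    exact (congrArg h hdd).trans ((map_zero h).trans (map_zero _).symm))
  exact ⟨e, _, he, hw⟩

namespace FracRepresentsExtOne

theorem annihilator_le_denominatorIdeal (he : FracRepresentsExtOne P h e) (q : P.complex.X 0) :
    Module.annihilator R X ≤ denominatorIdeal R (h q) := by
  intro a ha
  obtain ⟨w, -, hw⟩ := he
  obtain ⟨p, hp⟩ := exists_d_apply_eq_smul P ha q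
  exact mem_denominatorIdeal.2 ⟨w p, by rw [hw, hp, map_smul]⟩

theorem smul (he : FracRepresentsExtOne P h e) (r : R) :
    FracRepresentsExtOne P (r • h) (r • e) := by
  obtain ⟨w, hwe, hw⟩ := he
  refine ⟨r • w, hwe.smul r, fun p => ?_⟩
  rw [LinearMap.smul_apply, ← hw, Algebra.smul_def, ← map_mul]
  rfl

theorem map {X' : ModuleCat.{u} R} {Q : ProjectiveResolution X'} {f : X ⟶ X'}
    {φ : P.complex ⟶ Q.complex} (comm : φ.f 0 ≫ Q.π.f 0 = P.π.f 0 ≫ f)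
    {h : Q.complex.X 0 →ₗ[R] K} {e : ((Ext R _ 1).obj (op X')).obj (ModuleCat.of R R)}
    (he : FracRepresentsExtOne Q h e) :
    FracRepresentsExtOne P (h ∘ₗ (φ.f 0).hom) (((Ext R _ 1).map f.op).app _ e) := by
  obtain ⟨w, hwe, hw⟩ := he
  refine ⟨φ.f 1 ≫ w, hwe.map comm, fun p => (hw _).trans (congrArg h ?_)⟩
  exact ConcreteCategory.congr_hom (φ.comm 1 0) p

theorem eq_zero (hinj : Function.Injective (algebraMap R K)) (he : FracRepresentsExtOne P h e)
    (hh : ∀ q, ∃ b, algebraMap R K b = h q) : e = 0 := by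
  obtain ⟨w, hwe, hw⟩ := he
  obtain ⟨v, hv⟩ := exists_linearMap_of_forall_exists_algebraMap_eq hinj hh
  have hvw : P.complex.d 1 0 ≫ ModuleCat.ofHom v = w := by
    ext p
    exact hinj ((hv _).trans (hw p).symm)
  exact RepresentsExtOne.eq_zero (hvw ▸ hwe)

theorem exists_algebraMap_eq [IsFractionRing R K] (he : FracRepresentsExtOne P h 0) {s : R}
    (hsX : s ∈ Module.annihilator R X) (hs : s ∈ R⁰) (q : P.complex.X 0) :
    ∃ b, algebraMap R K b = h q := by
  obtain ⟨w, hw0, hw⟩ := he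
  obtain ⟨v, rfl⟩ := hw0.exists_d_comp_eq
  obtain ⟨p, hp⟩ := exists_d_apply_eq_smul P hsX q
  refine ⟨v q, (IsLocalization.map_units K (⟨s, hs⟩ : R⁰)).mul_left_cancel ?_⟩
  calc algebraMap R K s * algebraMap R K (v q)
      = algebraMap R K (v (P.complex.d 1 0 p)) := by
        rw [hp, map_smul, smul_eq_mul, map_mul]
    _ = algebraMap R K s * h q := by
        rw [← Algebra.smul_def, ← map_smul, ← hp]
        exact hw p

end FracRepresentsExtOne

theorem smul_ext_one_eq_zero [IsFractionRing R K] {s : R} (hsX : s ∈ Module.annihilator R X)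
    (hs : s ∈ R⁰) {r : R}
    (hr : ∀ x : K, Module.annihilator R X ≤ denominatorIdeal R x → r ∈ denominatorIdeal R x)
    (e : ((Ext R (ModuleCat.{u} R) 1).obj (op X)).obj (ModuleCat.of R R)) : r • e = 0 := by
  obtain ⟨h, he⟩ := exists_fracRepresentsExtOne (P := projectiveResolution X) (K := K) hsX hs e
  exact (he.smul r).eq_zero (IsFractionRing.injective R K) fun q =>
    mem_denominatorIdeal.1 (hr _ (he.annihilator_le_denominatorIdeal q))

theorem exists_mk_apply_eq_π (I : Ideal R)
    (P : ProjectiveResolution (ModuleCat.of R (R ⧸ I))) :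
    ∃ g : P.complex.X 0 →ₗ[R] R, ∀ q, Ideal.Quotient.mk I (g q) = P.π.f 0 q := by
  have : Epi (ModuleCat.ofHom I.mkQ) := (ModuleCat.epi_iff_surjective _).2 I.mkQ_surjective
  let π₀ : P.complex.X 0 ⟶ ModuleCat.of R (R ⧸ I) := P.π.f 0
  obtain ⟨g, hg⟩ := Projective.factors π₀ (ModuleCat.ofHom I.mkQ)
  exact ⟨g.hom, fun q => ConcreteCategory.congr_hom hg q⟩

theorem exists_ext_one_quotient_forall_map_eq_zero [IsFractionRing R K] {I : Ideal R} {x : K}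
    (hx : I ≤ denominatorIdeal R x) :
    ∃ e : ((Ext R (ModuleCat.{u} R) 1).obj (op (ModuleCat.of R (R ⧸ I)))).obj (ModuleCat.of R R),
      ∀ (J : Ideal R) (s : R), s ∈ J → s ∈ R⁰ →
        ∀ f : ModuleCat.of R (R ⧸ J) ⟶ ModuleCat.of R (R ⧸ I),
          f (Ideal.Quotient.mk J 1) = Ideal.Quotient.mk I 1 →
        ∀ r : R, ((Ext R (ModuleCat.{u} R) 1).map f.op).app (ModuleCat.of R R) (r • e) = 0 →
          r ∈ denominatorIdeal R x := by
  let Q := projectiveResolution (ModuleCat.of R (R ⧸ I))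
  obtain ⟨g, hg⟩ := exists_mk_apply_eq_π I Q
  have hgd (p : Q.complex.X 1) : g (Q.complex.d 1 0 p) ∈ I := by
    rw [← Ideal.Quotient.eq_zero_iff_mem, hg]
    exact ConcreteCategory.congr_hom Q.complex_d_comp_π_f_zero p
  obtain ⟨e, he⟩ := exists_fracRepresentsExtOne_of_forall (P := Q)
    (h := LinearMap.toSpanSingleton R K x ∘ₗ g) (IsFractionRing.injective R K)
    fun p => mem_denominatorIdeal.1 (hx (hgd p))
  refine ⟨e, fun J s hsJ hs f hf r hr => ?_⟩
  let P := projectiveResolution (ModuleCat.of R (R ⧸ J))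
  let φ := ProjectiveResolution.lift f P Q
  have comm : φ.f 0 ≫ Q.π.f 0 = P.π.f 0 ≫ f := ProjectiveResolution.lift_commutes_zero f P Q
  obtain ⟨p, hp⟩ : ∃ p : P.complex.X 0, P.π.f 0 p = Ideal.Quotient.mk J 1 :=
    (ModuleCat.epi_iff_surjective _).1 (inferInstance : Epi (P.π.f 0)) _
  have hgp : g (φ.f 0 p) - 1 ∈ I := by
    rw [← Ideal.Quotient.eq, hg, ← hf, ← hp]
    exact ConcreteCategory.congr_hom comm p
  have hsJ' : s ∈ Module.annihilator R (R ⧸ J) := by rwa [Ideal.annihilator_quotient]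
  have hmap := (he.smul r).map comm
  rw [hr] at hmap
  have hmem : r * g (φ.f 0 p) ∈ denominatorIdeal R x := by
    rw [mem_denominatorIdeal, mul_smul]
    exact hmap.exists_algebraMap_eq hsJ' hs p
  have := sub_mem hmem (Ideal.mul_mem_left _ r (hx hgp))
  rwa [← mul_sub, sub_sub_cancel, mul_one] at this

theorem mem_annihilator_localCohomology_one_iff [IsFractionRing R K] {I : Ideal R} (hI : I.FG)
    {s : R} (hsI : s ∈ I) (hs : s ∈ R⁰) {r : R} :
    r ∈ Module.annihilator R ((localCohomology I 1).obj (ModuleCat.of R R)) ↔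
      ∀ x : K, I ≤ (denominatorIdeal R x).radical → r ∈ denominatorIdeal R x := by
  let F := localCohomology.diagram (localCohomology.idealPowersDiagram I) 1
  let c := ((evaluation _ _).obj (ModuleCat.of R R)).mapCocone (Limits.colimit.cocone F)
  have hc : Limits.IsColimit c :=
    Limits.isColimitOfPreserves ((evaluation _ _).obj (ModuleCat.of R R))
      (Limits.colimit.isColimit F)
  have : Limits.PreservesFilteredColimitsOfSize.{0, 0} (forget (ModuleCat.{u} R)) :=
    Limits.preservesFilteredColimitsOfSize_shrink.{0, u, 0, u} _
  rw [Module.mem_annihilator]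
  constructor
  · intro h x hx
    obtain ⟨n, hn⟩ := Ideal.exists_pow_le_of_le_radical_of_fg hx hI
    obtain ⟨e, he⟩ := exists_ext_one_quotient_forall_map_eq_zero hn
    have h0 : c.ι.app (op (op n)) (r • e) = c.ι.app (op (op n)) 0 :=
      (map_smul (c.ι.app (op (op n))).hom r e).trans ((h _).trans (map_zero _).symm)
    obtain ⟨j, f, f', hff⟩ := (Limits.Concrete.isColimit_rep_eq_iff_exists _ hc _ _).1 h0
    rw [map_zero] at hff
    exact he (I ^ j.unop.unop) (s ^ j.unop.unop) (Ideal.pow_mem_pow hsI _) (pow_mem hs _)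
      ((localCohomology.ringModIdeals (localCohomology.idealPowersDiagram I)).map f.unop) rfl r hff
  · intro h y
    obtain ⟨j, e, rfl⟩ := Limits.Concrete.isColimit_exists_rep _ hc y
    have hann : Module.annihilator R (R ⧸ I ^ j.unop.unop) = I ^ j.unop.unop :=
      Ideal.annihilator_quotient
    have he : r • e = 0 := smul_ext_one_eq_zero (K := K)
      (X := ModuleCat.of R (R ⧸ I ^ j.unop.unop)) (s := s ^ j.unop.unop)
      (hann.symm ▸ Ideal.pow_mem_pow hsI _) (pow_mem hs _)
      (fun x hx => h x fun a ha => ⟨j.unop.unop, hx (hann.symm ▸ Ideal.pow_mem_pow ha _)⟩) e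
    exact (map_smul (c.ι.app j).hom r e).symm.trans ((congrArg (c.ι.app j) he).trans (map_zero _))

end Fractions

end ExtOne

theorem mainTheorem8 (R : Type*) [CommRing R] [IsLocalRing R] [IsNoetherianRing R]
    [IsAdicComplete (IsLocalRing.maximalIdeal R) R]
    (hdim : ringKrullDim R = 2) (hequi : IsEquidimensionalRing R)
    (hsn : IsSeminormalRing R) (hR1 : SatisfiesSerreR R 1) :
    IsBuchsbaumRing R ∧
    conductorIdeal R = Module.annihilator R
      ((localCohomology (IsLocalRing.maximalIdeal R) 1).obj (ModuleCat.of R R)) ∧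
    (¬ IsIntegrallyClosedIn R (FractionRing R) →
      conductorIdeal R = IsLocalRing.maximalIdeal R) := by
  have := hsn.isReduced
  have hR (p) (hp : p ∈ minimalPrimes R) : 1 < ringKrullDim (R ⧸ p) := by
    rw [hequi p hp, hdim]
    exact Nat.one_lt_ofNat
  obtain ⟨s, hsm, hs⟩ := exists_mem_maximalIdeal_mem_nonZeroDivisors fun p hp =>
    zero_lt_one.trans (hR p hp)
  have isIntegral_iff (x : FractionRing R) :
      IsIntegral R x ↔ maximalIdeal R ≤ (denominatorIdeal R x).radical :=
    ⟨maximalIdeal_le_radical_denominatorIdeal hdim.le hR1,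
      isIntegral_of_maximalIdeal_le_radical_denominatorIdeal hR⟩
  refine ⟨hsn.isBuchsbaumRing hdim hequi hR1, ?_, hsn.conductorIdeal_eq_maximalIdeal hdim.le hR1⟩
  ext r
  rw [mem_conductorIdeal, mem_annihilator_localCohomology_one_iff (K := FractionRing R)
    (maximalIdeal R).fg_of_isNoetherianRing hsm hs]
  exact forall_congr' fun x => by rw [isIntegral_iff x]
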